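/- Let $F$ be an infinite field with an algebraic closure $\tilde F$, and let $a(X),b(X)\in F[X]$ be nonzero relatively prime polynomials. Then there is an integer $n_0$ such that for every $n>n_0$ there exists $c(X)\in F[X]$ for which $f(X,Y)=a(X)+b(X)c(X)Y$ is irreducible as a polynomial in $X$ over $F(Y)$, has degree $n$ in $X$, and has Galois group (that is, the Galois group of its splitting field in $X$) over $\tilde F(Y)$ isomorphic to the symmetric group $S_n$. Moreover $c$ can be taken of the following explicit form, computed with the Euclidean algorithm. There are integers $e,k\ge 0$ with $e>n/2$, $\gcd(e,n)=1$, $e$ not divisible by $\operatorname{char} F$ if $\operatorname{char}F>0$, and $n=\deg b+e+2+(k+1)$; distinct nonzero $\alpha_1,\alpha_2\in F$; distinct $\gamma_1,\gamma_2\in F$ that are not roots of $a(X)b(X)$; and $\beta,\gamma,\delta\in F$ with $\delta\neq 0$, such that, with $p_1=(X-\gamma_1)^e$ and $p_2=(X-\gamma_2)^2$, $$c=p_1c_2+p_2c_1+\delta\,p_1p_2\,(X-\beta)^{k}(X-\gamma),$$ where $c_1,c_2\in F[X]$ are the polynomials with $\deg c_i<\deg p_i$ and $\alpha_1\,b\,p_2\,c_1\equiv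 -a \pmod{p_1}$, $\alpha_2\,b\,p_1\,c_2\equiv -a\pmod{p_2}$, obtained from the extended Euclidean algorithm. -/

import Mathlib

open Polynomial

namespace DirichletPoly

noncomputable section

/-- The polynomial `f(X,Y) = a(X) + b(X) c(X) Y`, viewed in `F[Y][X]`: the outer variable is `X`
and the inner one is `Y`. -/
def family {F : Type*} [Field F] (a b c : F[X]) : F[X][X] :=
  a.map (C : F →+* F[X]) + (b * c).map (C : F →+* F[X]) * C (X : F[X])

/-- A polynomial `f(X,Y)` over `F`, viewed as a polynomial in `X` over the field `K(Y)`, where `K`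
is an extension field of `F`. -/
def overRatFunc {F : Type*} [Field F] (K : Type*) [Field K] [Algebra F K] (f : F[X][X]) :
    (RatFunc K)[X] :=
  f.map ((algebraMap K[X] (RatFunc K)).comp (mapRingHom (algebraMap F K)))

open Classical in
/-- For `q` prime to `p`, the solution `x` of `q * x ≡ r (mod p)` with `deg x < deg p`, computed
by the extended Euclidean algorithm: `gcd q p = q * gcdA q p + p * gcdB q p`, where `gcd q p`
is a nonzero constant. -/
def solveMod {F : Type*} [Field F] (p q r : F[X]) : F[X] :=
  (r * EuclideanDomain.gcdA q p / EuclideanDomain.gcd q p) % p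

/-- The explicit polynomial `p₁ c₂ + p₂ c₁ + p₁ p₂ s`, where `cᵢ` is the solution of
`αᵢ b pⱼ cᵢ ≡ -a (mod pᵢ)`, `{i, j} = {1, 2}`, found by the Euclidean algorithm. -/
def euclidPoly {F : Type*} [Field F] (a b p₁ p₂ : F[X]) (α₁ α₂ : F) (s : F[X]) : F[X] :=
  p₁ * solveMod p₂ (C α₂ * b * p₁) (-a) + p₂ * solveMod p₁ (C α₁ * b * p₂) (-a) + p₁ * p₂ * s

/-- `c` is produced from `a`, `b` and `n` by the explicit Euclidean construction, with
`p₁ = (X - γ₁) ^ e`, `p₂ = (X - γ₂) ^ 2` and `s = δ (X - β) ^ k (X - γ)`. -/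
def IsEuclideanConstruction {F : Type*} [Field F] (a b : F[X]) (n : ℕ) (c : F[X]) : Prop :=
  ∃ (e k : ℕ) (α₁ α₂ γ₁ γ₂ β γ δ : F),
    n < 2 * e ∧ e.Coprime n ∧ (e : F) ≠ 0 ∧ n = b.natDegree + e + 2 + (k + 1) ∧
    α₁ ≠ 0 ∧ α₂ ≠ 0 ∧ α₁ ≠ α₂ ∧ γ₁ ≠ γ₂ ∧ (a * b).eval γ₁ ≠ 0 ∧ (a * b).eval γ₂ ≠ 0 ∧ δ ≠ 0 ∧
    c = euclidPoly a b ((X - C γ₁) ^ e) ((X - C γ₂) ^ 2) α₁ α₂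
      (C δ * (X - C β) ^ k * (X - C γ))

end

end DirichletPoly

/-! Write `f = a + b c Y`. It is linear in `Y`, so it is irreducible as soon as `a` is prime to `b
c`. The Galois group comes from two specializations: at `Y = α₁` the polynomial becomes `(X - γ₁) ^
e * g₁`, at `Y = α₂` it becomes `(X - γ₂) ^ 2 * g₂`, with `gᵢ` separable and nonzero at `γᵢ`. Over
the Laurent series in `Y - αᵢ`, Hensel's lemma splits off the roots of `gᵢ` and Eisenstein's
criterion at `γᵢ` makes the remaining factor irreducible (`exists_irreducible_factor`). The local
Galois group is therefore transitive on `e`, respectively two, roots and fixes the others. The first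
fact forces primitivity (`isPreprimitive_of_large_orbit`), the second gives a transposition, and
Jordan's theorem yields `S_n`. The quadratic factor may be wildly ramified: separability of `f` is
read off at `α₁`, where `e ≠ 0` in the field, so characteristic two needs no separate treatment.

The congruences modulo `p₁` and `p₂` produce the two multiple roots. Adding `δ p₁ p₂ s` preserves
them, and all but finitely many `δ` make everything else generic (`exists_euclidean_construction`).
-/

namespace DirichletPoly

/-! ### Permutation groups: primitivity and Jordan's theorem. -/

open MulAction Pointwise in
/-- A transitive permutation group of degree `n` with a subset `S`, of size `e > n / 2` prime to
`n`, on which the pointwise stabilizer of the complement is transitive, is primitive. -/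
theorem isPreprimitive_of_large_orbit {G α : Type*} [Group G] [MulAction G α] [Finite α]
    [IsPretransitive G α] (S : Set α) (hlarge : Nat.card α < 2 * S.ncard)
    (hcop : S.ncard.Coprime (Nat.card α))
    (hS : ∀ x ∈ S, ∀ y ∈ S, ∃ g : G, g • x = y ∧ ∀ z ∉ S, g • z = z) :
    IsPreprimitive G α := by
  classical
  refine ⟨fun {B} hB => ?_⟩
  by_cases hne : B.Nonempty
  swap
  · left
    rw [Set.not_nonempty_iff_eq_empty.mp hne]
    exact Set.subsingleton_empty
  -- A translate meeting both `S` and its complement is preserved by every element fixing the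
  -- complement, so it swallows `S` and exceeds half of `α`. Otherwise `S` is a disjoint union of
  -- translates, and `B.ncard` divides two coprime numbers.
  by_cases hmix : ∃ g : G, (∃ x ∈ g • B, x ∈ S) ∧ ∃ z ∈ g • B, z ∉ S
  · right
    obtain ⟨g, ⟨x, hxB, hxS⟩, z, hzB, hzS⟩ := hmix
    have hgB : IsBlock G (g • B) := hB.translate g
    have hsub : S ⊆ g • B := by
      intro y hy
      obtain ⟨h, hxy, hfix⟩ := hS x hxS y hy
      have : h • (g • B) = g • B :=
        isBlock_iff_smul_eq_of_mem.mp hgB hzB (by rw [hfix z hzS]; exact hzB)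
      rw [← this, ← hxy]
      exact Set.smul_mem_smul_set hxB
    have hcard : Nat.card α < (g • B).ncard * 2 := by
      have := Set.ncard_le_ncard hsub (Set.toFinite _)
      omega
    have huniv := hgB.eq_univ_of_card_lt hcard
    have : B = g⁻¹ • (g • B) := by simp
    rw [this, huniv, Set.smul_set_univ]
  · left
    push Not at hmix
    have hdvd : B.ncard ∣ S.ncard := by
      have hsub : ∀ g : G, (g • B ∩ S).Nonempty → g • B ⊆ S := by
        rintro g ⟨x, hx, hxS⟩ z hz
        exact hmix g ⟨x, hx, hxS⟩ z hz
      let T : Set (Set α) := {C | C ∈ orbit G B ∧ C ⊆ S}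
      have hST : S = ⋃₀ T := by
        ext x
        constructor
        · intro hx
          obtain ⟨b, hb⟩ := hne
          obtain ⟨g, hg⟩ := exists_smul_eq G b x
          have hxg : x ∈ g • B := hg ▸ Set.smul_mem_smul_set hb
          exact ⟨g • B, ⟨⟨g, rfl⟩, hsub g ⟨x, hxg, hx⟩⟩, hxg⟩
        · rintro ⟨C, hC, hx⟩
          exact hC.2 hx
      have hdisj : T.PairwiseDisjoint id := by
        rintro C ⟨⟨g, rfl⟩, -⟩ C' ⟨⟨g', rfl⟩, -⟩ hne'
        exact (hB.smul_eq_smul_or_disjoint g g').resolve_left hne'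
      have hTf : T.Finite := Set.toFinite _
      have : S.ncard = ∑ C ∈ hTf.toFinset, C.ncard := by
        rw [← finsum_mem_eq_finite_toFinset_sum]
        conv_lhs => rw [hST]
        rw [Set.sUnion_eq_biUnion]
        exact hTf.ncard_biUnion (fun C _ => Set.toFinite C) hdisj
      rw [this]
      refine Finset.dvd_sum fun C hC => ?_
      obtain ⟨⟨g, rfl⟩, -⟩ := hTf.mem_toFinset.mp hC
      exact (Set.ncard_smul_set g B).symm.dvd
    have h1 : B.ncard ∣ 1 := by
      rw [← Nat.coprime_iff_gcd_eq_one.mp hcop]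
      exact Nat.dvd_gcd hdvd (hB.ncard_dvd_card hne)
    have h2 : B.ncard = 1 := Nat.dvd_one.mp h1
    obtain ⟨x, hx⟩ := Set.ncard_eq_one.mp h2
    rw [hx]
    exact Set.subsingleton_singleton

/-- An action whose image contains a pointwise stabilizer acting transitively on a two-element
set has a transposition in its image. -/
theorem exists_isSwap_of_pair {G α : Type*} [Group G] [MulAction G α] [Finite α] [DecidableEq α]
    (S : Set α) (hcard : S.ncard = 2)
    (hS : ∀ x ∈ S, ∀ y ∈ S, ∃ g : G, g • x = y ∧ ∀ z ∉ S, g • z = z) :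
    ∃ g : G, (MulAction.toPerm g : Equiv.Perm α).IsSwap := by
  obtain ⟨x, y, hxy, rfl⟩ := Set.ncard_eq_two.mp hcard
  obtain ⟨g, hg, hfix⟩ := hS x (by simp) y (by simp)
  refine ⟨g, x, y, hxy, ?_⟩
  have hgy : g • y = x := by
    obtain ⟨w, hw⟩ := (MulAction.toPerm g : Equiv.Perm α).surjective x
    rw [MulAction.toPerm_apply] at hw
    by_cases hwx : w = x
    · rw [hwx, hg] at hw
      exact absurd hw.symm hxy
    by_cases hwy : w = y
    · rwa [hwy] at hw
    · rw [hfix w (by simp [hwx, hwy])] at hw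
      exact absurd hw hwx
  ext z
  rw [MulAction.toPerm_apply, Equiv.swap_apply_def]
  split_ifs with h1 h2
  · rw [h1, hg]
  · rw [h2, hgy]
  · exact hfix z (by simp [h1, h2])

open MulAction in
/-- A transitive action that is locally transitive on a large set of size prime to the degree, and
on a pair, induces all permutations. -/
theorem toPermHom_surjective_of_large_orbit_of_pair {G α : Type*} [Group G] [MulAction G α]
    [Finite α] [IsPretransitive G α] (S T : Set α) (hlarge : Nat.card α < 2 * S.ncard)
    (hcop : S.ncard.Coprime (Nat.card α))
    (hS : ∀ x ∈ S, ∀ y ∈ S, ∃ g : G, g • x = y ∧ ∀ z ∉ S, g • z = z) (hcard : T.ncard = 2)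
    (hT : ∀ x ∈ T, ∀ y ∈ T, ∃ g : G, g • x = y ∧ ∀ z ∉ T, g • z = z) :
    Function.Surjective (toPermHom G α) := by
  classical
  have hprim := isPreprimitive_of_large_orbit (G := G) S hlarge hcop hS
  obtain ⟨g, hg⟩ := exists_isSwap_of_pair (G := G) T hcard hT
  rw [← MonoidHom.range_eq_top]
  let φ : G → (toPermHom G α).range := (toPermHom G α).rangeRestrict
  let f : α →ₑ[φ] α := ⟨id, fun _ _ => rfl⟩
  have : IsPreprimitive (toPermHom G α).range α :=
    IsPreprimitive.of_surjective (f := f) Function.surjective_id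
  exact Equiv.Perm.subgroup_eq_top_of_isPreprimitive_of_isSwap_mem this _ hg ⟨g, rfl⟩

end DirichletPoly

/-! ### From local factorizations to local transitivity. -/

namespace DirichletPoly

/-- If a separable polynomial over `A` factors over an extension `M` into an irreducible factor
`q` and a split factor, then its Galois group acts transitively on a set of `deg q` roots,
keeping the other roots fixed. -/
theorem exists_roots_of_irreducible_factor {A M : Type*} [Field A] [Field M] [Algebra A M]
    (p : A[X]) (hp : p.Separable) (q g : M[X]) (hq : Irreducible q) (hg : g.Splits)
    (hfac : p.map (algebraMap A M) = q * g) :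
    ∃ S : Set (p.rootSet p.SplittingField), S.ncard = q.natDegree ∧
      ∀ x ∈ S, ∀ y ∈ S, ∃ σ : p.Gal, σ • x = y ∧ ∀ z ∉ S, σ • z = z := by
  classical
  let E := AlgebraicClosure M
  have : Fact ((p.map (algebraMap A E)).Splits) := ⟨IsAlgClosed.splits _⟩
  have hE : p.map (algebraMap A E) = q.map (algebraMap M E) * g.map (algebraMap M E) := by
    rw [IsScalarTower.algebraMap_eq A M E, ← Polynomial.map_map, hfac, Polynomial.map_mul]
  have hp0 : p ≠ 0 := hp.ne_zero
  have hqsep : q.Separable := by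
    have := hp.map (f := algebraMap A M)
    rw [hfac] at this
    exact this.of_mul_left
  let e := Gal.rootsEquivRoots p E
  let S' : Set (p.rootSet E) := {x | aeval (x : E) q = 0}
  have hroot : ∀ x : E, x ∈ p.rootSet E ↔ aeval x q = 0 ∨ aeval x g = 0 := by
    intro x
    rw [mem_rootSet_of_ne hp0, ← eval_map_algebraMap, hE, eval_mul, mul_eq_zero,
      eval_map_algebraMap, eval_map_algebraMap]
  have hS'card : S'.ncard = q.natDegree := by
    have h1 : (Subtype.val '' S') = q.rootSet E := by
      ext x
      rw [mem_rootSet_of_ne hq.ne_zero]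
      constructor
      · rintro ⟨y, hy, rfl⟩
        exact hy
      · intro hx
        exact ⟨⟨x, (hroot x).mpr (Or.inl hx)⟩, hx, rfl⟩
    rw [← Set.ncard_image_of_injective S' Subtype.val_injective, h1, ← Nat.card_coe_set_eq,
      Nat.card_eq_fintype_card, card_rootSet_eq_natDegree hqsep (IsAlgClosed.splits _)]
  -- Roots of `q` are conjugate over `M`, and roots of the split factor `g` lie in `M`; an
  -- `M`-automorphism of `E` does both jobs.
  have key : ∀ x ∈ S', ∀ y ∈ S', ∃ σ : p.Gal, σ • x = y ∧ ∀ z ∉ S', σ • z = z := by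
    intro x hx y hy
    have hmin : aeval (y : E) (minpoly M (x : E)) = 0 := by
      have := minpoly.eq_of_irreducible hq hx
      rw [← this, map_mul, show aeval (y : E) q = 0 from hy, zero_mul]
    obtain ⟨τ, hτ⟩ := minpoly.exists_algEquiv_of_root' (K := M) (Algebra.IsAlgebraic.isAlgebraic _) hmin
    refine ⟨Gal.restrict p E (τ.restrictScalars A), ?_, fun z hz => ?_⟩
    · apply Subtype.ext
      rw [Gal.restrict_smul]
      exact hτ
    · apply Subtype.ext
      rw [Gal.restrict_smul]
      have hzg : aeval (z : E) g = 0 := ((hroot z).mp z.2).resolve_left hz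
      have hg0 : g ≠ 0 := by
        rintro rfl
        rw [mul_zero] at hfac
        exact hp0 (Polynomial.map_eq_zero _ |>.mp hfac)
      have hzr : (g.map (algebraMap M E)).IsRoot (z : E) := by
        rw [IsRoot, eval_map_algebraMap, hzg]
      obtain ⟨w, hw⟩ := hg.mem_range_of_isRoot hg0 hzr
      change τ z = z
      rw [← hw, AlgEquiv.commutes]
  refine ⟨e ⁻¹' S', ?_, ?_⟩
  · rw [← hS'card]
    exact Set.ncard_preimage_of_injective_subset_range e.injective (by simp [e.surjective.range_eq])
  · intro x hx y hy
    obtain ⟨σ, hσ, hfix⟩ := key (e x) hx (e y) hy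
    have hsm : ∀ w, σ • e w = e (σ • w) := by
      intro w
      rw [Gal.smul_def, Equiv.symm_apply_apply]
    refine ⟨σ, e.injective ?_, fun z hz => e.injective ?_⟩
    · rw [← hsm, hσ]
    · rw [← hsm, hfix _ hz]

end DirichletPoly

/-! ### Hensel and Eisenstein over power series. -/

namespace DirichletPoly

theorem powerSeries_ker_constantCoeff (K : Type*) [Field K] :
    RingHom.ker (PowerSeries.constantCoeff (R := K)) = Ideal.span {PowerSeries.X} := by
  ext x
  rw [RingHom.mem_ker, Ideal.mem_span_singleton, PowerSeries.X_dvd_iff]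

/-- Eisenstein's criterion over power series, at a point `γ` other than zero. -/
theorem irreducible_of_map_constantCoeff_eq_pow {K : Type*} [Field K] (f : (PowerSeries K)[X])
    (hf : f.Monic) (γ : K) (e : ℕ) (he : 0 < e)
    (hmap : f.map PowerSeries.constantCoeff = (X - C γ) ^ e)
    (hsq : ¬ PowerSeries.X ^ 2 ∣ f.eval (PowerSeries.C γ)) : Irreducible f := by
  let : Algebra (PowerSeries K) K := (PowerSeries.constantCoeff (R := K)).toAlgebra
  have halg : algebraMap (PowerSeries K) K = PowerSeries.constantCoeff := rfl
  have hq : (X - C (PowerSeries.C γ)).map (algebraMap (PowerSeries K) K) = X - C γ := by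
    rw [halg]
    simp
  refine generalizedEisenstein (K := K) (q := X - C (PowerSeries.C γ)) (p := e) ?_
    (monic_X_sub_C _) hf.isPrimitive ?_ ?_ ?_ ?_
  · rw [hq]
    exact irreducible_X_sub_C γ
  · rw [← hf.natDegree_map (PowerSeries.constantCoeff (R := K)), hmap]
    simpa using he
  · simp [hf.leadingCoeff]
  · rw [hq, hf.leadingCoeff, halg, hmap]
    simp
  · rw [modByMonic_X_sub_C_eq_C_eval, map_C, Ne, C_eq_zero, Ideal.Quotient.eq_zero_iff_mem, halg,
      powerSeries_ker_constantCoeff, Ideal.span_singleton_pow, Ideal.mem_span_singleton]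
    exact hsq

/-- Hensel's lemma: a simple root of the reduction of a monic polynomial over power series
lifts. -/
theorem exists_root_lift {K : Type*} [Field K] (f : (PowerSeries K)[X]) (hf : f.Monic) (ρ : K)
    (hρ : (f.map PowerSeries.constantCoeff).eval ρ = 0)
    (hρ' : (derivative (f.map PowerSeries.constantCoeff)).eval ρ ≠ 0) :
    ∃ r : PowerSeries K, f.eval r = 0 ∧ PowerSeries.constantCoeff r = ρ := by
  have hev : ∀ p : (PowerSeries K)[X], PowerSeries.constantCoeff (p.eval (PowerSeries.C ρ)) =
      (p.map PowerSeries.constantCoeff).eval ρ := by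
    intro p
    rw [← eval₂_hom, ← eval_map, PowerSeries.constantCoeff_C]
  obtain ⟨r, hr, hrρ⟩ := HenselianRing.is_henselian (I := Ideal.span {(PowerSeries.X : PowerSeries K)})
    f hf (PowerSeries.C ρ) (by
      rw [Ideal.mem_span_singleton, PowerSeries.X_dvd_iff, hev, hρ])
    (by
      refine IsUnit.map _ (PowerSeries.isUnit_iff_constantCoeff.mpr ?_)
      rw [hev, ← derivative_map]
      exact hρ'.isUnit)
  refine ⟨r, hr, ?_⟩
  rw [Ideal.mem_span_singleton, PowerSeries.X_dvd_iff, map_sub, PowerSeries.constantCoeff_C,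
    sub_eq_zero] at hrρ
  exact hrρ

/-- Induction on the degree of `g`: each root of `g` is simple, so it lifts and a linear factor
splits off. The cofactor's value at `γ` divides the old one, so its order stays at most one. Once
`g` is exhausted, Eisenstein's criterion applies. -/
theorem exists_irreducible_factor_monic {K : Type*} [Field K] (γ : K) (e : ℕ) (he : 0 < e) (d : ℕ) :
    ∀ (f : (PowerSeries K)[X]) (g : K[X]), f.Monic →
    f.map PowerSeries.constantCoeff = (X - C γ) ^ e * g → g.natDegree = d → g.Separable →
    g.Splits → g.eval γ ≠ 0 → ¬ PowerSeries.X ^ 2 ∣ f.eval (PowerSeries.C γ) →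
    ∃ q h : (PowerSeries K)[X], f = q * h ∧ q.Monic ∧ Irreducible q ∧ q.natDegree = e ∧
      h.Splits := by
  induction d with
  | zero =>
    intro f g hf hmap hd _ _ _ hsq
    have hg : g = 1 := by
      have h1 : ((X - C γ) ^ e * g).Monic := hmap ▸ hf.map _
      have h2 : g.Monic := ((monic_X_sub_C γ).pow e).of_mul_monic_left h1
      exact h2.natDegree_eq_zero.mp hd
    rw [hg, mul_one] at hmap
    refine ⟨f, 1, (mul_one f).symm, hf, irreducible_of_map_constantCoeff_eq_pow f hf γ e he hmap hsq,
      ?_, Splits.one⟩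
    rw [← hf.natDegree_map (PowerSeries.constantCoeff (R := K)), hmap]
    simp
  | succ d ih =>
    intro f g hf hmap hd hsep hspl hγ hsq
    obtain ⟨ρ, hρ⟩ := hspl.exists_eval_eq_zero (by
      intro h0
      have := natDegree_eq_zero_iff_degree_le_zero.mpr h0.le
      omega)
    obtain ⟨g', rfl⟩ := dvd_iff_isRoot.mpr hρ
    have hργ : γ - ρ ≠ 0 := by
      intro h
      apply hγ
      rw [eval_mul, eval_sub, eval_X, eval_C, h, zero_mul]
    have hg'ρ : g'.eval ρ ≠ 0 := by
      intro h
      obtain ⟨g'', rfl⟩ := dvd_iff_isRoot.mpr h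
      exact (prime_X_sub_C ρ).not_isUnit
        (hsep.squarefree _ ⟨g'', by ring⟩)
    have hg0 : (X - C ρ) * g' ≠ 0 := hsep.ne_zero
    obtain ⟨r, hr, hrρ⟩ := exists_root_lift f hf ρ
      (by rw [hmap]; simp)
      (by
        rw [hmap, show (X - C γ) ^ e * ((X - C ρ) * g') = (X - C ρ) * ((X - C γ) ^ e * g') by ring,
          derivative_mul]
        have : ρ - γ ≠ 0 := by
          intro h
          exact hργ (by rw [← neg_sub, h, neg_zero])
        simp [this, hg'ρ])
    obtain ⟨f', rfl⟩ := dvd_iff_isRoot.mpr hr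
    have hf' : f'.Monic := (monic_X_sub_C r).of_mul_monic_left hf
    have hmap' : f'.map PowerSeries.constantCoeff = (X - C γ) ^ e * g' := by
      rw [Polynomial.map_mul] at hmap
      simp only [Polynomial.map_sub, map_X, map_C, hrρ] at hmap
      refine mul_left_cancel₀ (X_sub_C_ne_zero ρ) ?_
      rw [hmap]
      ring
    obtain ⟨q, h, hfac, hqm, hqi, hqe, hh⟩ := ih f' g' hf' hmap'
      (by
        rw [natDegree_mul (X_sub_C_ne_zero ρ) (right_ne_zero_of_mul hg0), natDegree_X_sub_C] at hd
        omega)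
      hsep.of_mul_right (hspl.of_dvd hg0 (dvd_mul_left _ _))
      (fun h => hγ (by rw [eval_mul, h, mul_zero]))
      (fun h => hsq (by rw [eval_mul]; exact h.mul_left _))
    refine ⟨q, (X - C r) * h, by rw [hfac]; ring, hqm, hqi, hqe, (Splits.X_sub_C r).mul hh⟩

/-- A polynomial over power series whose reduction has a root `γ` of multiplicity `e`, all other
roots simple, and which takes at `γ` a value of order one, has over Laurent series an irreducible
factor of degree `e` with split cofactor. -/
theorem exists_irreducible_factor {K : Type*} [Field K] (γ : K) (e : ℕ) (he : 0 < e)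
    (f : (PowerSeries K)[X]) (g : K[X]) (hf : IsUnit f.leadingCoeff)
    (hmap : f.map PowerSeries.constantCoeff = (X - C γ) ^ e * g) (hsep : g.Separable)
    (hspl : g.Splits) (hγ : g.eval γ ≠ 0)
    (hsq : ¬ PowerSeries.X ^ 2 ∣ f.eval (PowerSeries.C γ)) :
    ∃ q h : (LaurentSeries K)[X],
      f.map (algebraMap (PowerSeries K) (LaurentSeries K)) = q * h ∧ Irreducible q ∧
        q.natDegree = e ∧ h.Splits := by
  obtain ⟨u, hu⟩ := hf
  have hv : PowerSeries.constantCoeff (↑u⁻¹ : PowerSeries K) ≠ 0 :=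
    (PowerSeries.isUnit_iff_constantCoeff.mp u⁻¹.isUnit).ne_zero
  obtain ⟨q, h, hfac, hqm, hqi, hqe, hh⟩ := exists_irreducible_factor_monic γ e he _
    (C (↑u⁻¹ : PowerSeries K) * f)
    (C (PowerSeries.constantCoeff (↑u⁻¹ : PowerSeries K)) * g)
    (by
      rw [Monic, leadingCoeff_mul, leadingCoeff_C, ← hu, Units.inv_mul])
    (by
      rw [Polynomial.map_mul, hmap, map_C]
      ring) rfl
    (hsep.unit_mul (isUnit_C.mpr hv.isUnit))
    ((Splits.C _).mul hspl)
    (by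
      rw [eval_mul, eval_C]
      exact mul_ne_zero hv hγ)
    (by
      rw [eval_mul, eval_C]
      intro hdvd
      exact hsq ((Units.dvd_mul_left (u := u⁻¹)).mp hdvd))
  have hf : f = q * (C (↑u : PowerSeries K) * h) := by
    rw [mul_left_comm, ← hfac, ← mul_assoc, ← C_mul, Units.mul_inv, C_1, one_mul]
  refine ⟨q.map (algebraMap _ _), (C (↑u : PowerSeries K) * h).map (algebraMap _ _), ?_, ?_, ?_, ?_⟩
  · rw [← Polynomial.map_mul, ← hf]
  · exact (hqm.irreducible_iff_irreducible_map_fraction_map).mp hqi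
  · rw [hqm.natDegree_map, hqe]
  · exact ((Splits.C _).mul hh).map _

end DirichletPoly

/-! ### The Galois group of the family. -/

namespace DirichletPoly

theorem exists_roots_of_irreducible_factor_ringHom {A M : Type*} [Field A] [Field M] (ι : A →+* M)
    (p : A[X]) (hp : p.Separable) (q g : M[X]) (hq : Irreducible q) (hg : g.Splits)
    (hfac : p.map ι = q * g) :
    ∃ S : Set (p.rootSet p.SplittingField), S.ncard = q.natDegree ∧
      ∀ x ∈ S, ∀ y ∈ S, ∃ σ : p.Gal, σ • x = y ∧ ∀ z ∉ S, σ • z = z := by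
  let := ι.toAlgebra
  exact exists_roots_of_irreducible_factor p hp q g hq hg hfac

/-- The Galois group of an irreducible separable polynomial of degree `n` is the symmetric group
if over two extensions of the base field the polynomial is a split polynomial times an irreducible
one of degree `e`, with `e > n / 2` prime to `n`, respectively of degree two. -/
theorem nonempty_gal_mulEquiv_perm {A M : Type*} [Field A] [Field M] (p : A[X])
    (hp : p.Separable) (hirr : Irreducible p) {e n : ℕ} (hn : p.natDegree = n) (hlarge : n < 2 * e)
    (hcop : e.Coprime n) (ι₁ ι₂ : A →+* M)
    (h₁ : ∃ q g : M[X], p.map ι₁ = q * g ∧ Irreducible q ∧ q.natDegree = e ∧ g.Splits)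
    (h₂ : ∃ q g : M[X], p.map ι₂ = q * g ∧ Irreducible q ∧ q.natDegree = 2 ∧ g.Splits) :
    Nonempty (p.Gal ≃* Equiv.Perm (Fin n)) := by
  obtain ⟨q₁, g₁, hfac₁, hq₁, hd₁, hg₁⟩ := h₁
  obtain ⟨q₂, g₂, hfac₂, hq₂, hd₂, hg₂⟩ := h₂
  obtain ⟨S, hSc, hS⟩ := exists_roots_of_irreducible_factor_ringHom ι₁ p hp q₁ g₁ hq₁ hg₁ hfac₁
  obtain ⟨T, hTc, hT⟩ := exists_roots_of_irreducible_factor_ringHom ι₂ p hp q₂ g₂ hq₂ hg₂ hfac₂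
  have hcard : Nat.card (p.rootSet p.SplittingField) = n := by
    rw [Nat.card_eq_fintype_card, card_rootSet_eq_natDegree hp (SplittingField.splits p), hn]
  have : MulAction.IsPretransitive p.Gal (p.rootSet p.SplittingField) := by
    refine ⟨fun x y => ?_⟩
    have hx := minpoly.eq_of_irreducible hirr (mem_rootSet.mp x.2).2
    have hy := minpoly.eq_of_irreducible hirr (mem_rootSet.mp y.2).2
    obtain ⟨g, hg⟩ := (Normal.minpoly_eq_iff_mem_orbit p.SplittingField).mp (hy.symm.trans hx)
    exact ⟨g, Subtype.ext hg⟩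
  have hsurj := toPermHom_surjective_of_large_orbit_of_pair (G := p.Gal) S T
    (by rw [hcard, hSc, hd₁]; exact hlarge) (by rw [hcard, hSc, hd₁]; exact hcop) hS
    (by rw [hTc, hd₂]) hT
  have hinj : Function.Injective (MulAction.toPermHom p.Gal (p.rootSet p.SplittingField)) := by
    intro σ τ h
    refine Gal.ext p fun x hx => ?_
    exact congrArg Subtype.val (DFunLike.congr_fun h ⟨x, hx⟩)
  let ε : p.rootSet p.SplittingField ≃ Fin n := Finite.equivFinOfCardEq hcard
  exact ⟨(MulEquiv.ofBijective _ ⟨hinj, hsurj⟩).trans ε.permCongrHom⟩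

/-- Used to embed `K(Y)` into Laurent series by expansion at `α₁` and at `α₂`. -/
theorem exists_comp_algebraMap_eq {R A M : Type*} [CommRing R] [IsDomain R] [Field A] [Field M]
    [Algebra R A] [IsFractionRing R A] (φ : R →+* M) (hφ : Function.Injective φ) :
    ∃ ι : A →+* M, ι.comp (algebraMap R A) = φ :=
  ⟨IsFractionRing.lift hφ, RingHom.ext fun x => IsFractionRing.lift_algebraMap hφ x⟩

section Family

variable {K : Type*} [Field K]

theorem natDegree_family (a b c : K[X]) (hdeg : a.natDegree < (b * c).natDegree) :
    (family a b c).natDegree = (b * c).natDegree := by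
  have h0 : b * c ≠ 0 := by
    rintro h
    simp [h] at hdeg
  have h1 : ((b * c).map (C : K →+* K[X]) * C (X : K[X])).natDegree = (b * c).natDegree := by
    rw [natDegree_mul_C X_ne_zero, natDegree_map]
  rw [family, natDegree_add_eq_right_of_natDegree_lt, h1]
  rwa [h1, natDegree_map]

/-- Expanded at `Y = α` this is a unit exactly when `α ≠ 0`, whence the condition on `α₁` and `α₂`.
-/
theorem leadingCoeff_family (a b c : K[X]) (hdeg : a.natDegree < (b * c).natDegree) :
    (family a b c).leadingCoeff = C (b * c).leadingCoeff * X := by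
  rw [leadingCoeff, natDegree_family a b c hdeg, family, coeff_add, coeff_mul_C, coeff_map,
    coeff_map, coeff_eq_zero_of_natDegree_lt hdeg, C_0, zero_add, leadingCoeff]

theorem irreducible_family (a b c : K[X]) (hcop : IsCoprime a (b * c))
    (hdeg : a.natDegree < (b * c).natDegree) : Irreducible (family a b c) := by
  have h0 : b * c ≠ 0 := by
    rintro h
    simp [h] at hdeg
  rw [← MulEquiv.irreducible_iff (Bivariate.swap (R := K))]
  have : Bivariate.swap (family a b c) = C (b * c) * X + C a := by
    rw [family, map_add, map_mul, Bivariate.swap_map_C, Bivariate.swap_map_C, Bivariate.swap_X,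
      add_comm]
  rw [this]
  exact irreducible_C_mul_X_add_C h0 hcop.symm.isRelPrime

theorem irreducible_map_family (a b c : K[X]) (hcop : IsCoprime a (b * c))
    (hdeg : a.natDegree < (b * c).natDegree) :
    Irreducible ((family a b c).map (algebraMap K[X] (RatFunc K))) := by
  have h := irreducible_family a b c hcop hdeg
  refine (IsPrimitive.irreducible_iff_irreducible_map_fraction_map (h.isPrimitive ?_)).mp h
  rw [natDegree_family a b c hdeg]
  omega

theorem map_family {L : Type*} [CommRing L] (a b c : K[X]) (φ : K[X] →+* L) :
    (family a b c).map φ = a.map (φ.comp C) + (b * c).map (φ.comp C) * C (φ X) := by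
  rw [family, Polynomial.map_add, Polynomial.map_mul, Polynomial.map_map, Polynomial.map_map, map_C]

/-- The expansion of a polynomial in powers of `X - α`, as a power series. -/
noncomputable def taylorSeries (α : K) : K[X] →+* PowerSeries K :=
  coeToPowerSeries.ringHom.comp (taylorAlgHom α : K[X] →+* K[X])

theorem taylorSeries_injective (α : K) : Function.Injective (taylorSeries α) :=
  (coe_injective K).comp (taylor_injective α)

theorem taylorSeries_X (α : K) : taylorSeries α X = PowerSeries.X + PowerSeries.C α := by
  simp [taylorSeries]

theorem taylorSeries_comp_C (α : K) : (taylorSeries α).comp C = PowerSeries.C := by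
  ext x : 1
  simp [taylorSeries]

theorem constantCoeff_comp_taylorSeries (α : K) :
    (PowerSeries.constantCoeff (R := K)).comp (taylorSeries α) = evalRingHom α := by
  refine Polynomial.ringHom_ext (fun x => ?_) ?_
  · have := RingHom.congr_fun (taylorSeries_comp_C α) x
    simp only [RingHom.comp_apply] at this ⊢
    simp [this]
  · simp [taylorSeries_X]

/-- With `Y = α + T` the polynomial is `(a + α b c) + T b c`, so its value at `γ` is `T` times `(b
c)(γ)`. That constant is nonzero, as otherwise `a` would vanish at `γ` too. -/
theorem exists_irreducible_factor_family [IsAlgClosed K] (a b c : K[X]) (hcop : IsCoprime a (b * c))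
    (hdeg : a.natDegree < (b * c).natDegree) (α γ : K) (hα : α ≠ 0) (e : ℕ) (he : 0 < e) (g : K[X])
    (hfac : a + C α * (b * c) = (X - C γ) ^ e * g) (hsep : g.Separable) (hγ : g.eval γ ≠ 0) :
    ∃ q h : (LaurentSeries K)[X],
      (family a b c).map ((algebraMap (PowerSeries K) (LaurentSeries K)).comp (taylorSeries α)) =
        q * h ∧ Irreducible q ∧ q.natDegree = e ∧ h.Splits := by
  rw [← Polynomial.map_map]
  have h0 : b * c ≠ 0 := by
    rintro h
    simp [h] at hdeg
  have hroot : a.eval γ + α * (b * c).eval γ = 0 := by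
    have := congrArg (eval γ) hfac
    simpa [he.ne'] using this
  have hbc : (b * c).eval γ ≠ 0 := by
    intro h
    rw [h, mul_zero, add_zero] at hroot
    rcases aeval_ne_zero_of_isCoprime hcop γ with h1 | h1
    · exact h1 (by simpa using hroot)
    · exact h1 (by simpa using h)
  have hinj := taylorSeries_injective α
  have hC : ∀ x, taylorSeries α (C x) = PowerSeries.C x :=
    fun x => RingHom.congr_fun (taylorSeries_comp_C α) x
  refine exists_irreducible_factor γ e he _ g ?_ ?_ hsep (IsAlgClosed.splits g) hγ ?_
  · rw [leadingCoeff_map_of_injective hinj, leadingCoeff_family a b c hdeg, map_mul, hC,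
      taylorSeries_X, PowerSeries.isUnit_iff_constantCoeff]
    simp [hα, leadingCoeff_ne_zero.mpr h0, -leadingCoeff_mul]
  · rw [Polynomial.map_map, constantCoeff_comp_taylorSeries, map_family, ← hfac]
    have : (evalRingHom α).comp (C : K →+* K[X]) = RingHom.id K := by
      ext x
      simp
    rw [this, Polynomial.map_id, Polynomial.map_id, coe_evalRingHom, eval_X]
    ring
  · have hev : ∀ p : K[X], (p.map (PowerSeries.C (R := K))).eval (PowerSeries.C γ) =
        PowerSeries.C (p.eval γ) := by
      intro p
      rw [eval_map, eval₂_hom]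
    rw [map_family, taylorSeries_comp_C, taylorSeries_X, eval_add, eval_mul, eval_C, hev, hev,
      mul_add, ← map_mul, add_comm (_ * PowerSeries.X), ← add_assoc, ← map_add,
      mul_comm ((b * c).eval γ), hroot, map_zero, zero_add, PowerSeries.X_pow_dvd_iff]
    intro h
    have := h 1 one_lt_two
    rw [PowerSeries.coeff_C_mul, PowerSeries.coeff_one_X, mul_one] at this
    exact hbc this

/-- By irreducibility only a zero derivative must be excluded. At `Y = α` the derivative is `(X - γ)
^ (e - 1)` times a polynomial with value `e g(γ) ≠ 0` at `γ`. -/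
theorem separable_map_family (a b c : K[X]) (hcop : IsCoprime a (b * c))
    (hdeg : a.natDegree < (b * c).natDegree) (α γ : K) (e : ℕ) (he : (e : K) ≠ 0) (g : K[X])
    (hfac : a + C α * (b * c) = (X - C γ) ^ e * g) (hγ : g.eval γ ≠ 0) :
    ((family a b c).map (algebraMap K[X] (RatFunc K))).Separable := by
  rw [separable_iff_derivative_ne_zero (irreducible_map_family a b c hcop hdeg), derivative_map,
    Polynomial.map_ne_zero_iff (IsFractionRing.injective K[X] (RatFunc K))]
  intro h
  have h1 := congrArg (Polynomial.map (evalRingHom α)) h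
  have : (evalRingHom α).comp (C : K →+* K[X]) = RingHom.id K := by
    ext x
    simp
  rw [← derivative_map, map_family, Polynomial.map_zero, this, Polynomial.map_id, Polynomial.map_id,
    coe_evalRingHom, eval_X, mul_comm, hfac, derivative_mul, derivative_X_sub_C_pow] at h1
  obtain ⟨d, rfl⟩ := Nat.exists_eq_succ_of_ne_zero (show e ≠ 0 by rintro rfl; simp at he)
  have h2 : (X - C γ) ^ d * (C ((d + 1 : ℕ) : K) * g + (X - C γ) * derivative g) = 0 := by
    rw [← h1]
    simp only [Nat.succ_eq_add_one, Nat.add_sub_cancel]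
    ring
  have h3 := (mul_eq_zero.mp h2).resolve_left (pow_ne_zero _ (X_sub_C_ne_zero γ))
  have h4 := congrArg (eval γ) h3
  simp only [eval_add, eval_mul, eval_C, eval_sub, eval_X, sub_self, zero_mul, add_zero,
    eval_zero] at h4
  exact mul_ne_zero he hγ h4

theorem nonempty_gal_family_mulEquiv_perm [IsAlgClosed K] (a b c : K[X])
    (hcop : IsCoprime a (b * c)) {n e : ℕ} (hn : (b * c).natDegree = n) (hdeg : a.natDegree < n)
    (hlarge : n < 2 * e) (hen : e.Coprime n) (he : (e : K) ≠ 0) (α₁ α₂ γ₁ γ₂ : K) (hα₁ : α₁ ≠ 0)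
    (hα₂ : α₂ ≠ 0) (g₁ g₂ : K[X]) (hfac₁ : a + C α₁ * (b * c) = (X - C γ₁) ^ e * g₁)
    (hsep₁ : g₁.Separable) (hγ₁ : g₁.eval γ₁ ≠ 0)
    (hfac₂ : a + C α₂ * (b * c) = (X - C γ₂) ^ 2 * g₂)
    (hsep₂ : g₂.Separable) (hγ₂ : g₂.eval γ₂ ≠ 0) :
    Nonempty (((family a b c).map (algebraMap K[X] (RatFunc K))).Gal ≃* Equiv.Perm (Fin n)) := by
  subst hn
  have hinj : ∀ α : K, Function.Injective
      ((algebraMap (PowerSeries K) (LaurentSeries K)).comp (taylorSeries α)) := fun α =>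
    (IsFractionRing.injective (PowerSeries K) (LaurentSeries K)).comp (taylorSeries_injective α)
  obtain ⟨ι₁, hι₁⟩ := exists_comp_algebraMap_eq (A := RatFunc K) _ (hinj α₁)
  obtain ⟨ι₂, hι₂⟩ := exists_comp_algebraMap_eq (A := RatFunc K) _ (hinj α₂)
  refine nonempty_gal_mulEquiv_perm (M := LaurentSeries K) _
    (separable_map_family a b c hcop hdeg α₁ γ₁ e he g₁ hfac₁ hγ₁)
    (irreducible_map_family a b c hcop hdeg) ?_ hlarge hen
    ι₁ ι₂ ?_ ?_
  · rw [natDegree_map_eq_of_injective (IsFractionRing.injective K[X] (RatFunc K)),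
      natDegree_family a b c hdeg]
  · rw [Polynomial.map_map, hι₁]
    exact exists_irreducible_factor_family a b c hcop hdeg α₁ γ₁ hα₁ e (by omega) g₁ hfac₁ hsep₁ hγ₁
  · rw [Polynomial.map_map, hι₂]
    exact exists_irreducible_factor_family a b c hcop hdeg α₂ γ₂ hα₂ 2 two_pos g₂ hfac₂ hsep₂ hγ₂

end Family

end DirichletPoly

/-! ### Congruences, generic members of pencils, and the choice of `e`. -/

namespace DirichletPoly

section Choice

variable {F : Type*} [Field F]

theorem solveMod_spec (p q r : F[X]) (h : IsCoprime q p) : p ∣ q * solveMod p q r - r := by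
  classical
  have hg : IsUnit (EuclideanDomain.gcd q p) := EuclideanDomain.gcd_isUnit_iff.mpr h
  have hbez := EuclideanDomain.gcd_eq_gcd_ab q p
  unfold solveMod
  set g := EuclideanDomain.gcd q p with hgdef
  set y := r * EuclideanDomain.gcdA q p / g with hy
  have hgy : g * y = r * EuclideanDomain.gcdA q p := EuclideanDomain.mul_div_cancel' hg.ne_zero hg.dvd
  have h1 : p ∣ q * y - r := by
    refine (hg.dvd_mul_left).mp ⟨-(EuclideanDomain.gcdB q p * r), ?_⟩
    rw [mul_sub, mul_left_comm, hgy]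
    linear_combination -r * hbez
  have h2 : p ∣ y % p - y := by
    refine ⟨-(y / p), ?_⟩
    have := EuclideanDomain.div_add_mod y p
    linear_combination this
  have : q * (y % p) - r = q * (y % p - y) + (q * y - r) := by ring
  convert dvd_add (h2.mul_left q) h1 using 1

theorem degree_solveMod_lt (p q r : F[X]) (hp : p ≠ 0) : (solveMod p q r).degree < p.degree :=
  EuclideanDomain.mod_lt _ hp

/-- A pencil `u + δ v` has a common root with `w` for only finitely many `δ`. -/
theorem finite_not_isCoprime (w u v : F[X]) (hw : w ≠ 0)
    (h : ∀ x : AlgebraicClosure F, aeval x w = 0 → aeval x u = 0 → aeval x v ≠ 0) :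
    {δ : F | ¬ IsCoprime w (u + C δ * v)}.Finite := by
  have hfin := (w.rootSet_finite (AlgebraicClosure F)).image fun x => -(aeval x u / aeval x v)
  refine (hfin.preimage (f := algebraMap F (AlgebraicClosure F))
    (FaithfulSMul.algebraMap_injective _ _).injOn).subset ?_
  intro δ hδ
  rw [Set.mem_ofPred_eq, isCoprime_iff_aeval_ne_zero_of_isAlgClosed F (AlgebraicClosure F)] at hδ
  push Not at hδ
  obtain ⟨x, hxw, hx⟩ := hδ
  refine ⟨x, (mem_rootSet_of_ne hw).mpr hxw, ?_⟩
  simp only [map_add, map_mul, aeval_C] at hx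
  have hv : aeval x v ≠ 0 := by
    intro hv
    rw [hv, mul_zero, add_zero] at hx
    exact h x hxw hx hv
  change -(aeval x u / aeval x v) = _
  field_simp
  linear_combination -hx

/-- A multiple root of `u + δ v` is a root of the Wronskian `u' v - u v'`, which does not depend on
`δ`. The simple root `γ` of `v` keeps the Wronskian nonzero, even in positive characteristic. -/
theorem finite_not_separable (u v : F[X]) (huv : IsCoprime u v) (γ : F) (hγ : v.eval γ = 0)
    (hγ' : (derivative v).eval γ ≠ 0) : {δ : F | ¬ (u + C δ * v).Separable}.Finite := by
  have huγ : u.eval γ ≠ 0 := by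
    intro h
    rcases aeval_ne_zero_of_isCoprime huv γ with h1 | h1
    · exact h1 (by simpa using h)
    · exact h1 (by simpa using hγ)
  have hw : derivative u * v - u * derivative v ≠ 0 := by
    intro h
    have := congrArg (eval γ) h
    simp [hγ, huγ, hγ'] at this
  refine (finite_not_isCoprime _ u v hw fun x _ hu hv => ?_).subset fun δ hδ hcop => hδ ?_
  · rcases aeval_ne_zero_of_isCoprime huv x with h1 | h1
    · exact h1 hu
    · exact h1 hv
  · have h1 : derivative u * v - u * derivative v =
        derivative (u + C δ * v) * v + (u + C δ * v) * -derivative v := by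
      simp only [derivative_add, derivative_mul, derivative_C]
      ring
    rw [h1] at hcop
    exact (hcop.of_add_mul_left_left.of_mul_left_left).symm

theorem isCoprime_X_sub_C_pow (γ : F) (m : ℕ) (u : F[X]) (h : u.eval γ ≠ 0) :
    IsCoprime u ((X - C γ) ^ m) := by
  refine IsCoprime.pow_right (IsCoprime.symm ?_)
  exact ((irreducible_X_sub_C γ).coprime_iff_not_dvd).mpr fun hd => h (dvd_iff_isRoot.mp hd)

theorem exists_eval_ne_zero [Infinite F] (u : F[X]) (hu : u ≠ 0) : ∃ x, u.eval x ≠ 0 := by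
  by_contra! h
  exact hu (Polynomial.funext fun x => by rw [h x, eval_zero])

/-- Here `t` stands for `n - e`. If `p ∣ n`, any `t` prime to `n` is prime to `p`, and a `t` just
below `n / 2` serves; in characteristic zero the same `t` works. If `p > 0` does not divide `n`, a
power of `p` serves. -/
theorem exists_coprime_small (F : Type*) [Field F] (B : ℕ) : ∃ N : ℕ, ∀ n, N < n →
    ∃ t, B ≤ t ∧ 2 * t < n ∧ t.Coprime n ∧ ((n - t : ℕ) : F) ≠ 0 := by
  obtain ⟨p, hp⟩ := CharP.exists F
  refine ⟨2 * p ^ (B + 1) + 2 * B + 4, fun n hn => ?_⟩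
  by_cases hpn : p ∣ n ∨ p = 0
  · have key : ∃ t, B ≤ t ∧ 2 * t < n ∧ t.Coprime n := by
      rcases Nat.even_or_odd' n with ⟨m, rfl | rfl⟩
      · rcases Nat.even_or_odd' m with ⟨l, rfl | rfl⟩
        · refine ⟨2 * l - 1, by omega, by omega, ?_⟩
          have h2 : 2 * (2 * l) = 2 * (2 * l - 1) + 2 := by omega
          rw [h2, mul_comm, Nat.coprime_mul_right_add_right]
          exact Nat.Coprime.symm (Nat.coprime_two_left.mpr ⟨l - 1, by omega⟩)
        · refine ⟨2 * l - 1, by omega, by omega, ?_⟩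
          have h2 : 2 * (2 * l + 1) = 2 * (2 * l - 1) + 2 ^ 2 := by omega
          rw [h2, mul_comm, Nat.coprime_mul_right_add_right]
          exact (Nat.Coprime.symm (Nat.coprime_two_left.mpr ⟨l - 1, by omega⟩)).pow_right 2
      · refine ⟨m, by omega, by omega, ?_⟩
        rw [Nat.coprime_mul_right_add_right]
        exact Nat.coprime_one_right m
    obtain ⟨t, hB, ht, hcop⟩ := key
    refine ⟨t, hB, ht, hcop, ?_⟩
    rw [Ne, CharP.cast_eq_zero_iff F p]
    intro hd
    rcases hpn with hpn | rfl
    · have hpt : p ∣ t := (Nat.dvd_sub_iff_right (by omega) hpn).mp hd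
      exact CharP.char_ne_one F p (Nat.dvd_one.mp (hcop ▸ Nat.dvd_gcd hpt hpn))
    · rw [zero_dvd_iff] at hd
      omega
  · push Not at hpn
    have hpp : p.Prime := (CharP.char_is_prime_or_zero F p).resolve_right hpn.2
    have hlt : B + 1 < p ^ (B + 1) := Nat.lt_pow_self hpp.one_lt
    refine ⟨p ^ (B + 1), by omega, by omega, (hpp.coprime_iff_not_dvd.mpr hpn.1).pow_left _, ?_⟩
    rw [Ne, CharP.cast_eq_zero_iff F p]
    intro hd
    exact hpn.1 ((Nat.dvd_sub_iff_left (by omega) (dvd_pow_self p (by omega : B + 1 ≠ 0))).mp hd)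

end Choice

end DirichletPoly

/-! ### The explicit construction of `c`. -/

namespace DirichletPoly

section Choice

variable {F : Type*} [Field F]

theorem overRatFunc_family (K : Type*) [Field K] [Algebra F K] (a b c : F[X]) :
    overRatFunc K (family a b c) =
      (family (a.map (algebraMap F K)) (b.map (algebraMap F K)) (c.map (algebraMap F K))).map
        (algebraMap K[X] (RatFunc K)) := by
  have : (mapRingHom (algebraMap F K)).comp (C : F →+* F[X]) =
      (C : K →+* K[X]).comp (algebraMap F K) := by
    ext x
    simp
  rw [overRatFunc, ← Polynomial.map_map, map_family, this, coe_mapRingHom, map_X, family,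
    ← Polynomial.map_map, ← Polynomial.map_map, Polynomial.map_mul (f := algebraMap F K)]

/-- If `a + α b c₀` is `p₁ A₁` for `α = α₁` and vanishes at `γ₂` to positive order for `α = α₂`,
then `A₁` is prime to `b` and does not vanish at `γ₂`. -/
theorem isCoprime_cofactor {a b c₀ p₁ A₁ : F[X]} {α₁ α₂ γ₂ : F} (m : ℕ) (hm : 0 < m)
    (hab : IsCoprime a b) (hγ₂ : a.eval γ₂ ≠ 0) (hα : α₁ ≠ α₂)
    (h₁ : a + C α₁ * (b * c₀) = p₁ * A₁) (h₂ : (X - C γ₂) ^ m ∣ a + C α₂ * (b * c₀)) :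
    IsCoprime A₁ b ∧ A₁.eval γ₂ ≠ 0 := by
  constructor
  · have : IsCoprime (p₁ * A₁) b := by
      rw [← h₁, show C α₁ * (b * c₀) = b * (C α₁ * c₀) by ring]
      exact hab.add_mul_left_left _
    exact this.of_mul_left_right
  · intro h
    have e₁ := congrArg (eval γ₂) h₁
    have e₂ : (a + C α₂ * (b * c₀)).eval γ₂ = 0 := dvd_iff_isRoot.mp ((dvd_pow_self _ hm.ne').trans h₂)
    simp only [eval_add, eval_mul, eval_C, h, mul_zero] at e₁ e₂
    -- Eliminating `b c₀` from the two relations isolates `a`.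
    have : (α₂ - α₁) * a.eval γ₂ = 0 := by linear_combination α₂ * e₁ - α₁ * e₂
    rcases mul_eq_zero.mp this with h' | h'
    · exact hα (sub_eq_zero.mp h').symm
    · exact hγ₂ h'

theorem exists_euclidean_construction [Infinite F] (a b : F[X]) (ha : a ≠ 0) (hb : b ≠ 0)
    (hab : IsCoprime a b) {e k : ℕ} (he : 0 < e) :
    ∃ (α₁ α₂ γ₁ γ₂ β γ δ : F) (c g₁ g₂ : F[X]),
      α₁ ≠ 0 ∧ α₂ ≠ 0 ∧ α₁ ≠ α₂ ∧ γ₁ ≠ γ₂ ∧ (a * b).eval γ₁ ≠ 0 ∧ (a * b).eval γ₂ ≠ 0 ∧ δ ≠ 0 ∧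
      c = euclidPoly a b ((X - C γ₁) ^ e) ((X - C γ₂) ^ 2) α₁ α₂
        (C δ * (X - C β) ^ k * (X - C γ)) ∧
      c.natDegree = e + 2 + (k + 1) ∧ IsCoprime a c ∧
      a + C α₁ * (b * c) = (X - C γ₁) ^ e * g₁ ∧ g₁.Separable ∧ g₁.eval γ₁ ≠ 0 ∧
      a + C α₂ * (b * c) = (X - C γ₂) ^ 2 * g₂ ∧ g₂.Separable ∧ g₂.eval γ₂ ≠ 0 := by
  obtain ⟨γ₁, hγ₁⟩ := exists_eval_ne_zero (a * b) (mul_ne_zero ha hb)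
  obtain ⟨γ₂, hγ₂'⟩ := exists_eval_ne_zero (a * b * (X - C γ₁))
    (mul_ne_zero (mul_ne_zero ha hb) (X_sub_C_ne_zero γ₁))
  obtain ⟨α₂, hα₂'⟩ := exists_eval_ne_zero ((X : F[X]) * (X - C 1))
    (mul_ne_zero X_ne_zero (X_sub_C_ne_zero 1))
  have hγ₂ : (a * b).eval γ₂ ≠ 0 := fun h => hγ₂' (by rw [eval_mul, h, zero_mul])
  have hγ : γ₁ ≠ γ₂ := fun h => hγ₂' (by simp [h])
  have hα₂ : α₂ ≠ 0 := fun h => hα₂' (by simp [h])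
  have hα : (1 : F) ≠ α₂ := fun h => hα₂' (by simp [← h])
  have ha₁ : a.eval γ₁ ≠ 0 := fun h => hγ₁ (by rw [eval_mul, h, zero_mul])
  have ha₂ : a.eval γ₂ ≠ 0 := fun h => hγ₂ (by rw [eval_mul, h, zero_mul])
  have hb₁ : b.eval γ₁ ≠ 0 := fun h => hγ₁ (by rw [eval_mul, h, mul_zero])
  have hb₂ : b.eval γ₂ ≠ 0 := fun h => hγ₂ (by rw [eval_mul, h, mul_zero])
  have hγ₁₂ : γ₁ - γ₂ ≠ 0 := sub_ne_zero.mpr hγ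
  have hγ₂₁ : γ₂ - γ₁ ≠ 0 := sub_ne_zero.mpr hγ.symm
  set p₁ := (X - C γ₁) ^ e with hp₁
  set p₂ := (X - C γ₂) ^ 2 with hp₂
  have hp₁m : p₁.Monic := (monic_X_sub_C γ₁).pow e
  have hp₂m : p₂.Monic := (monic_X_sub_C γ₂).pow 2
  have hp₁e : p₁.eval γ₂ ≠ 0 := by simp [hp₁, hγ₂₁]
  have hp₂e : p₂.eval γ₁ ≠ 0 := by simp [hp₂, hγ₁₂]
  have hp₁d : p₁.natDegree = e := by rw [hp₁, natDegree_pow, natDegree_X_sub_C, mul_one]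
  have hp₂d : p₂.natDegree = 2 := by rw [hp₂, natDegree_pow, natDegree_X_sub_C]
  set c₁ := solveMod p₁ (C 1 * b * p₂) (-a) with hc₁
  set c₂ := solveMod p₂ (C α₂ * b * p₁) (-a) with hc₂
  set c₀ := p₁ * c₂ + p₂ * c₁ with hc₀
  have hdvd₁ : p₁ ∣ a + C 1 * (b * c₀) := by
    have h := solveMod_spec p₁ (C 1 * b * p₂) (-a)
      (isCoprime_X_sub_C_pow γ₁ e _ (by simp [hb₁, hp₂e]))
    rw [← hc₁] at h
    rw [show a + C 1 * (b * c₀) = (C 1 * b * p₂ * c₁ - -a) + p₁ * (C 1 * b * c₂) by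
      rw [hc₀]; ring]
    exact dvd_add h (dvd_mul_right _ _)
  have hdvd₂ : p₂ ∣ a + C α₂ * (b * c₀) := by
    have h := solveMod_spec p₂ (C α₂ * b * p₁) (-a)
      (isCoprime_X_sub_C_pow γ₂ 2 _ (by simp [hb₂, hp₁e, hα₂]))
    rw [← hc₂] at h
    rw [show a + C α₂ * (b * c₀) = (C α₂ * b * p₁ * c₂ - -a) + p₂ * (C α₂ * b * c₁) by
      rw [hc₀]; ring]
    exact dvd_add h (dvd_mul_right _ _)
  obtain ⟨A₁, hA₁⟩ := hdvd₁
  obtain ⟨A₂, hA₂⟩ := hdvd₂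
  obtain ⟨hA₁b, hA₁γ⟩ := isCoprime_cofactor 2 two_pos hab ha₂ hα hA₁ ⟨A₂, hA₂⟩
  obtain ⟨hA₂b, hA₂γ⟩ := isCoprime_cofactor e he hab ha₁ hα.symm hA₂ ⟨A₁, hA₁⟩
  have hA₁0 : A₁ ≠ 0 := by
    rintro rfl
    simp at hA₁γ
  have hA₂0 : A₂ ≠ 0 := by
    rintro rfl
    simp at hA₂γ
  -- Keeping `β` and `γ` off these roots makes `t` below prime to `a`, `A₁`, `A₂` and nonzero at
  -- `γ₁`, `γ₂`. The power of `X - β` only adjusts the degree; `X - γ` supplies the simple root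
  -- needed for separability.
  have hbad : a * b * p₁ * p₂ * A₁ * A₂ ≠ 0 := by
    simp only [ne_eq, mul_eq_zero, not_or]
    exact ⟨⟨⟨⟨⟨ha, hb⟩, hp₁m.ne_zero⟩, hp₂m.ne_zero⟩, hA₁0⟩, hA₂0⟩
  obtain ⟨β, hβ⟩ := exists_eval_ne_zero _ hbad
  obtain ⟨γ, hγ'⟩ := exists_eval_ne_zero _ (mul_ne_zero hbad (X_sub_C_ne_zero β))
  simp only [eval_mul, ne_eq, mul_eq_zero, not_or] at hβ hγ'
  obtain ⟨⟨⟨⟨⟨haβ, hbβ⟩, hp₁β⟩, hp₂β⟩, hA₁β⟩, hA₂β⟩ := hβ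
  obtain ⟨⟨⟨⟨⟨⟨haγ, hbγ⟩, hp₁γ⟩, hp₂γ⟩, hA₁γ'⟩, hA₂γ'⟩, hβγ⟩ := hγ'
  have hne : ∀ {x y : F} {m : ℕ}, 0 < m → ((X - C x) ^ m).eval y ≠ 0 → x - y ≠ 0 := by
    intro x y m hm h h0
    apply h
    rw [eval_pow, eval_sub, eval_X, eval_C, ← neg_sub, h0, neg_zero, zero_pow hm.ne']
  have hβ₁ : γ₁ - β ≠ 0 := hne he hp₁β
  have hβ₂ : γ₂ - β ≠ 0 := hne two_pos hp₂β
  have hγγ₁ : γ₁ - γ ≠ 0 := hne he hp₁γ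
  have hγγ₂ : γ₂ - γ ≠ 0 := hne two_pos hp₂γ
  set t := (X - C β) ^ k * (X - C γ) with ht
  have ht₁ : t.eval γ₁ ≠ 0 := by simp [ht, hβ₁, hγγ₁]
  have ht₂ : t.eval γ₂ ≠ 0 := by simp [ht, hβ₂, hγγ₂]
  have hcopt : ∀ u : F[X], u.eval β ≠ 0 → u.eval γ ≠ 0 → IsCoprime u t := by
    intro u h1 h2
    refine (isCoprime_X_sub_C_pow β k u h1).mul_right ?_
    simpa using isCoprime_X_sub_C_pow γ 1 u h2
  have htγ : t.eval γ = 0 := by simp [ht]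
  have hderiv : ∀ u : F[X], u.eval γ ≠ 0 → (derivative (u * t)).eval γ ≠ 0 := by
    have hβγ' : γ - β ≠ 0 := by simpa using hβγ
    have htγ' : (derivative t).eval γ ≠ 0 := by
      rw [ht, derivative_mul]
      simp [hβγ']
    intro u hu
    rw [derivative_mul, eval_add, eval_mul, htγ, mul_zero, zero_add, eval_mul]
    exact mul_ne_zero hu htγ'
  have hC : ∀ x : F, x ≠ 0 → ∀ u : F[X], IsCoprime u (C x) := fun x hx u =>
    ⟨0, C x⁻¹, by rw [zero_mul, zero_add, ← C_mul, inv_mul_cancel₀ hx, C_1]⟩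
  -- Passing from `c₀` to `c₀ + δ p₁ p₂ t` replaces `Aᵢ` by `Aᵢ + δ αᵢ b pⱼ t`. The exceptional `δ`
  -- are those spoiling separability (`f₁`, `f₂`), nonvanishing at `γᵢ` (`f₃`, `f₄`) or coprimality
  -- of `a` and `c` (`f₅`).
  have f₁ := finite_not_separable A₁ (C 1 * b * p₂ * t)
    ((((hC 1 one_ne_zero A₁).mul_right hA₁b).mul_right
      (isCoprime_X_sub_C_pow γ₂ 2 A₁ hA₁γ)).mul_right (hcopt A₁ hA₁β hA₁γ')) γ
    (by rw [eval_mul, htγ, mul_zero]) (hderiv _ (by simp [hbγ, hp₂γ]))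
  have f₂ := finite_not_separable A₂ (C α₂ * b * p₁ * t)
    ((((hC α₂ hα₂ A₂).mul_right hA₂b).mul_right
      (isCoprime_X_sub_C_pow γ₁ e A₂ hA₂γ)).mul_right (hcopt A₂ hA₂β hA₂γ')) γ
    (by rw [eval_mul, htγ, mul_zero]) (hderiv _ (by simp [hbγ, hp₁γ, hα₂]))
  have hroot : ∀ (x : F) (v : F[X]), v.eval x ≠ 0 → ∀ y : AlgebraicClosure F,
      aeval y (X - C x) = 0 → aeval y v ≠ 0 := by
    intro x v hv y hy
    rw [map_sub, aeval_X, aeval_C, sub_eq_zero] at hy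
    rw [hy, aeval_algebraMap_apply, coe_aeval_eq_eval]
    simpa using hv
  have f₃ := finite_not_isCoprime (X - C γ₁) A₁ (C 1 * b * p₂ * t) (X_sub_C_ne_zero γ₁)
    fun x hx _ => hroot γ₁ _ (by simp [hb₁, hp₂e, ht₁]) x hx
  have f₄ := finite_not_isCoprime (X - C γ₂) A₂ (C α₂ * b * p₁ * t) (X_sub_C_ne_zero γ₂)
    fun x hx _ => hroot γ₂ _ (by simp [hb₂, hp₁e, ht₂, hα₂]) x hx
  have f₅ := finite_not_isCoprime a c₀ (p₁ * p₂ * t) ha (by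
    intro x hx _ h
    have hcop : IsCoprime a (p₁ * p₂ * t) := ((isCoprime_X_sub_C_pow γ₁ e a ha₁).mul_right
      (isCoprime_X_sub_C_pow γ₂ 2 a ha₂)).mul_right (hcopt a haβ haγ)
    rcases aeval_ne_zero_of_isCoprime hcop x with h1 | h1
    · exact h1 hx
    · exact h1 h)
  obtain ⟨δ, hδ⟩ := (((((f₁.union f₂).union f₃).union f₄).union f₅).union
    (Set.finite_singleton (0 : F))).exists_notMem
  simp only [Set.mem_union, not_or, Set.mem_ofPred_eq, not_not, Set.mem_singleton_iff] at hδ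
  obtain ⟨⟨⟨⟨⟨h₁, h₂⟩, h₃⟩, h₄⟩, h₅⟩, hδ0⟩ := hδ
  have heval : ∀ (x : F) (u : F[X]), IsCoprime (X - C x) u → u.eval x ≠ 0 := by
    intro x u h hu
    rcases aeval_ne_zero_of_isCoprime h x with h1 | h1
    · exact h1 (by simp)
    · exact h1 (by simpa using hu)
  have hs : C δ * (X - C β) ^ k * (X - C γ) = C δ * t := by rw [ht, mul_assoc]
  have hc : euclidPoly a b p₁ p₂ 1 α₂ (C δ * (X - C β) ^ k * (X - C γ)) =
      c₀ + C δ * (p₁ * p₂ * t) := by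
    rw [hs, euclidPoly, ← hc₁, ← hc₂, hc₀]
    ring
  have htd : t.natDegree = k + 1 := by
    rw [ht, natDegree_mul (pow_ne_zero _ (X_sub_C_ne_zero β)) (X_sub_C_ne_zero γ), natDegree_pow,
      natDegree_X_sub_C, natDegree_X_sub_C, mul_one]
  have ht0 : t ≠ 0 := by
    intro h
    simp [h] at ht₁
  have hptd : (C δ * (p₁ * p₂ * t)).natDegree = e + 2 + (k + 1) := by
    rw [natDegree_C_mul hδ0, natDegree_mul (mul_ne_zero hp₁m.ne_zero hp₂m.ne_zero) ht0,
      natDegree_mul hp₁m.ne_zero hp₂m.ne_zero, hp₁d, hp₂d, htd]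
  have hc₀d : c₀.degree < ((e + 2 : ℕ) : WithBot ℕ) := by
    have hmul : ((e + 2 : ℕ) : WithBot ℕ) = (p₁ * p₂).degree := by
      rw [degree_eq_natDegree (mul_ne_zero hp₁m.ne_zero hp₂m.ne_zero),
        natDegree_mul hp₁m.ne_zero hp₂m.ne_zero, hp₁d, hp₂d]
    rw [hmul]
    refine (degree_add_le _ _).trans_lt (max_lt ?_ ?_)
    · rw [degree_mul, degree_mul]
      exact WithBot.add_lt_add_left (degree_ne_bot.mpr hp₁m.ne_zero)
        (degree_solveMod_lt p₂ _ _ hp₂m.ne_zero)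
    · rw [mul_comm p₂, degree_mul, degree_mul]
      exact WithBot.add_lt_add_right (degree_ne_bot.mpr hp₂m.ne_zero)
        (degree_solveMod_lt p₁ _ _ hp₁m.ne_zero)
  refine ⟨1, α₂, γ₁, γ₂, β, γ, δ, _, A₁ + C δ * (C 1 * b * p₂ * t), A₂ + C δ * (C α₂ * b * p₁ * t),
    one_ne_zero, hα₂, hα, hγ, hγ₁, hγ₂, hδ0, rfl, ?_, ?_, ?_, h₁, heval _ _ h₃, ?_, h₂,
    heval _ _ h₄⟩
  · rw [hc, natDegree_add_eq_right_of_degree_lt, hptd]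
    refine hc₀d.trans_le ?_
    rw [degree_eq_natDegree (fun h => by simp [h] at hptd), hptd]
    exact_mod_cast Nat.le_add_right _ _
  · rw [hc]
    exact h₅
  · rw [hc]
    linear_combination hA₁
  · rw [hc]
    linear_combination hA₂

end Choice

end DirichletPoly

/-! ### Assembly. -/

open DirichletPoly in
theorem propositionB {F : Type*} [Field F] [Infinite F]
    {Ω : Type*} [Field Ω] [Algebra F Ω] [IsAlgClosure F Ω]
    (a b : F[X]) (ha : a ≠ 0) (hb : b ≠ 0) (hab : IsCoprime a b) :
    ∃ n₀ : ℕ, ∀ n : ℕ, n₀ < n → ∃ c : F[X],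
      Irreducible (DirichletPoly.overRatFunc F (DirichletPoly.family a b c)) ∧
      (DirichletPoly.family a b c).natDegree = n ∧
      Nonempty ((DirichletPoly.overRatFunc Ω (DirichletPoly.family a b c)).Gal ≃*
        Equiv.Perm (Fin n)) ∧
      DirichletPoly.IsEuclideanConstruction a b n c := by
  -- With `e = n - t`, the degree equation forces `k = t - deg b - 3`; the bound on `t` makes this
  -- subtraction exact.
  obtain ⟨N, hN⟩ := exists_coprime_small F (b.natDegree + 3)
  refine ⟨max N a.natDegree, fun n hn => ?_⟩
  obtain ⟨hnN, hna⟩ := max_lt_iff.mp hn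
  obtain ⟨t, htB, htn, htcop, htF⟩ := hN n hnN
  have he : 0 < n - t := by omega
  have hlarge : n < 2 * (n - t) := by omega
  have hcop : (n - t).Coprime n := (Nat.coprime_self_sub_left (by omega)).mpr htcop
  obtain ⟨α₁, α₂, γ₁, γ₂, β, γ, δ, c, g₁, g₂, hα₁, hα₂, hα, hγ, hγ₁, hγ₂, hδ, hc, hcd, hac, hfac₁,
    hsep₁, hg₁, hfac₂, hsep₂, hg₂⟩ :=
    exists_euclidean_construction a b ha hb hab (k := t - b.natDegree - 3) he
  have hn : n = b.natDegree + (n - t) + 2 + (t - b.natDegree - 3 + 1) := by omega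
  have hbc : (b * c).natDegree = n := by
    rw [natDegree_mul hb (by rintro rfl; simp at hcd), hcd]
    omega
  have habc : IsCoprime a (b * c) := hab.mul_right hac
  have hdeg : a.natDegree < (b * c).natDegree := hbc ▸ hna
  refine ⟨c, ?_, ?_, ?_, n - t, t - b.natDegree - 3, α₁, α₂, γ₁, γ₂, β, γ, δ, hlarge, hcop, htF, hn,
    hα₁, hα₂, hα, hγ, hγ₁, hγ₂, hδ, hc⟩
  · rw [overRatFunc_family, Algebra.algebraMap_self, Polynomial.map_id, Polynomial.map_id,
      Polynomial.map_id]
    exact irreducible_map_family a b c habc hdeg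
  · rw [natDegree_family a b c hdeg, hbc]
  · have := IsAlgClosure.isAlgClosed F (K := Ω)
    -- The construction lives over `F`; the factorizations, separability, coprimality and
    -- nonvanishing all survive extension to `Ω`.
    set φ := algebraMap F Ω with hφ
    have hev : ∀ (u : F[X]) (x : F), u.eval x ≠ 0 → (u.map φ).eval (φ x) ≠ 0 := by
      intro u x h
      rw [eval_map, eval₂_hom]
      exact (map_ne_zero φ).mpr h
    have hfac : ∀ (α γ : F) (m : ℕ) (g : F[X]), a + C α * (b * c) = (X - C γ) ^ m * g →
        a.map φ + C (φ α) * (b.map φ * c.map φ) = (X - C (φ γ)) ^ m * g.map φ := by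
      intro α γ m g h
      simpa using congrArg (Polynomial.map φ) h
    rw [overRatFunc_family]
    refine nonempty_gal_family_mulEquiv_perm (a.map φ) (b.map φ) (c.map φ) ?_ ?_ ?_ hlarge hcop ?_
      (φ α₁) (φ α₂) (φ γ₁) (φ γ₂) ((map_ne_zero φ).mpr hα₁) ((map_ne_zero φ).mpr hα₂)
      (g₁.map φ) (g₂.map φ) (hfac _ _ _ _ hfac₁) hsep₁.map (hev _ _ hg₁)
      (hfac _ _ _ _ hfac₂) hsep₂.map (hev _ _ hg₂)
    · rw [← Polynomial.map_mul]
      exact habc.map (mapRingHom φ)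
    · rw [← Polynomial.map_mul, natDegree_map, hbc]
    · rwa [natDegree_map]
    · rw [← map_natCast φ]
      exact (map_ne_zero φ).mpr htF
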